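/- Let $\Gamma$ be a finitely generated nonamenable group with identity $e$, and let $\|\cdot\|$ be the word norm associated to a finite generating set of $\Gamma$. Let $\mu$ be a probability measure on $\Gamma$ (not assumed symmetric) that is generating, i.e. the semigroup generated by its support is all of $\Gamma$, and that has finite exponential moment, i.e. $\sum_{g\in\Gamma} e^{r\|g\|}\mu(g)<\infty$ for some $r>0$ (a condition which does not depend on the choice of the word norm). Let $$G(x,y)=\sum_{n=0}^{\infty}\mu^{*n}(x^{-1}y)\qquad (x,y\in\Gamma)$$ be the Green function of $\mu$, where $\mu^{*n}$ is the $n$-fold convolution power of $\mu$ and $\mu^{*0}=\delta_e$. Then there is a constant $C>0$ such that $$\frac{1}{C}\,e^{-C\|x^{-1}y\|}\le G(x,y)\le C\,e^{-\|x^{-1}y\|/C}\qquad\text{for all }x,y\in\Gamma.$$ Moreover, the (possibly asymmetric) Green metric $d_G(x,y)=-\log\frac{G(x,y)}{G(e,e)}$ is quasi-isometric to the word metric: there are $K\ge 1$ and $A\ge 0$ such that $$\frac{1}{K}\|x^{-1}y\|-A\le d_G(x,y)\le K\|x^{-1}y\|+A\qquad\text{for all }x,y\in\Gamma.$$ -/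

import Mathlib

open scoped ENNReal Pointwise

noncomputable section

/-- The discrete group `Γ` is amenable: there is a finitely additive probability measure, defined on
all subsets of `Γ`, which is invariant under left translations. -/
def IsAmenableGroup (Γ : Type*) [Group Γ] : Prop :=
  ∃ m : Set Γ → ℝ≥0∞, m Set.univ = 1 ∧
    (∀ s t : Set Γ, Disjoint s t → m (s ∪ t) = m s + m t) ∧
    ∀ (g : Γ) (s : Set Γ), m (g • s) = m s

/-- The word norm `‖g‖` with respect to `S`: the distance from `1` to `g` in the Cayley graph, whose
edges join `x` to `x * s` for `s ∈ S`. It is used only when `S` is finite and generates `Γ`. -/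
def wordNorm {Γ : Type*} [Group Γ] (S : Finset Γ) (g : Γ) : ℕ :=
  (SimpleGraph.mulCayley (S : Set Γ)).dist 1 g

/-- `μ` has finite exponential moment with respect to some word norm:
`∑ g, exp (r * ‖g‖) * μ g < ∞` for some `r > 0`. -/
def HasFiniteExpMoment {Γ : Type*} [Group Γ] (μ : PMF Γ) : Prop :=
  ∃ S : Finset Γ, Subgroup.closure (S : Set Γ) = ⊤ ∧
    ∃ r : ℝ, 0 < r ∧ ∑' g : Γ, ENNReal.ofReal (Real.exp (r * wordNorm S g)) * μ g < ∞

/-- `μ` is generating: the semigroup generated by its support is the whole group. -/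
def IsGenerating {Γ : Type*} [Group Γ] (μ : PMF Γ) : Prop :=
  Subsemigroup.closure μ.support = ⊤

/-- The `n`-fold convolution power of `μ`, that is, the law at time `n` of the random walk started
at `1` with independent increments (on the right) of law `μ`. -/
def convPow {Γ : Type*} [Group Γ] (μ : PMF Γ) : ℕ → PMF Γ
  | 0 => PMF.pure 1
  | n + 1 => (convPow μ n).bind fun g => μ.map fun h => g * h

/-- The Green function `G(x, y) = ∑ n ≥ 0, μ^{*n}(x⁻¹ y)`, possibly infinite. -/
def green {Γ : Type*} [Group Γ] (μ : PMF Γ) (x y : Γ) : ℝ≥0∞ :=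
  ∑' n : ℕ, convPow μ n (x⁻¹ * y)

/-- The (possibly asymmetric) Green metric `d_G(x, y) = - log (G(x, y) / G(1, 1))`; meaningful when
the values of `G` are positive and finite. -/
def greenDist {Γ : Type*} [Group Γ] (μ : PMF Γ) (x y : Γ) : ℝ :=
  -Real.log ((green μ x y).toReal / (green μ 1 1).toReal)

/-- `f` is a quasi-isometry from `(X, d)` to `(Y, d')`, for possibly asymmetric `d`, `d'`. -/
def IsQuasiIsometry {X Y : Type*} (d : X → X → ℝ) (d' : Y → Y → ℝ) (f : X → Y) : Prop :=
  ∃ K A : ℝ, 1 ≤ K ∧ 0 ≤ A ∧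
    (∀ x x' : X, d x x' / K - A ≤ d' (f x) (f x') ∧ d' (f x) (f x') ≤ K * d x x' + A) ∧
    ∀ y : Y, ∃ x : X, d' (f x) y ≤ A ∧ d' y (f x) ≤ A

end

/-! Lower bound: each letter of `S ∪ S⁻¹` is hit with positive probability at some time, so
concatenating along a geodesic word gives `c ^ ‖x‖ ≤ μ^{*m}(x)` for some `m`. Upper bound: Kesten's
theorem gives `μ^{*n}(x) ≤ ρ ^ n` with `ρ < 1`, and the exponential moment gives `exp (r‖x‖)
μ^{*n}(x) ≤ M ^ n`. A weighted geometric mean of the two (`exists_geometric_bound`) yields `q ^ n *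
exp (-c‖x‖)`, which is summed over `n`. Kesten's theorem is proved without self-adjointness: if unit
vectors are almost preserved in norm by the average, strict convexity makes all their translates by
the support close to the average. A charge at the identity makes them almost invariant, and limits
of the masses `|f_k|²` give an invariant mean. That charge comes from the lazy walk `(δ₁ + μ) / 2`,
whose Green function dominates that of `μ`. Taking logarithms gives the quasi-isometry. -/

open Filter Topology

/-! ### Averages of isometries and almost maximal vectors -/

section Average

variable {Γ E : Type*} [NormedAddCommGroup E] [InnerProductSpace ℝ E]

/-- The average `∑ g, w g • U g f` of the translates of `f` under a family of isometries. -/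
noncomputable def isometryAverage (U : Γ → E →ₗᵢ[ℝ] E) (w : Γ → ℝ) (f : E) : E :=
  ∑' g, w g • U g f

variable {U : Γ → E →ₗᵢ[ℝ] E} {w : Γ → ℝ}

theorem isometryAverage_smul (c : ℝ) (f : E) :
    isometryAverage U w (c • f) = c • isometryAverage U w f := by
  simp only [isometryAverage, map_smul]
  rw [← tsum_const_smul'']
  simp only [smul_comm c]

theorem hasSum_isometryAverage [CompleteSpace E] (hw : ∀ g, 0 ≤ w g) (hw1 : HasSum w 1) (f : E) :
    HasSum (fun g => w g • U g f) (isometryAverage U w f) := by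
  refine Summable.hasSum (Summable.of_norm ?_)
  simpa [norm_smul, abs_of_nonneg (hw _)] using hw1.summable.mul_right ‖f‖

theorem norm_isometryAverage_le (hw : ∀ g, 0 ≤ w g) (hw1 : HasSum w 1) (f : E) :
    ‖isometryAverage U w f‖ ≤ ‖f‖ := by
  have h : HasSum (fun g => w g * ‖f‖) ‖f‖ := by simpa using hw1.mul_right ‖f‖
  refine tsum_of_norm_bounded h fun g => ?_
  simp [norm_smul, abs_of_nonneg (hw _)]

/-- Quantitative strict convexity: the numbers `1 - ⟪u, U h f⟫` are nonnegative with weighted sum `1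
- ‖u‖²`, so each weighted term is at most that sum. -/
theorem mul_norm_sub_isometryAverage_sq_le [CompleteSpace E] (hw : ∀ g, 0 ≤ w g)
    (hw1 : HasSum w 1) {f : E} (hf : ‖f‖ = 1) (g : Γ) :
    w g * ‖U g f - isometryAverage U w f‖ ^ 2 ≤ 2 * (1 - ‖isometryAverage U w f‖ ^ 2) := by
  set u := isometryAverage U w f with hu
  have hu1 : ‖u‖ ≤ 1 := hf ▸ norm_isometryAverage_le hw hw1 f
  have hin (h : Γ) : inner ℝ u (U h f) ≤ 1 :=
    (real_inner_le_norm _ _).trans (by simpa [hf] using hu1)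
  have h1 : HasSum (fun h => w h * inner ℝ u (U h f)) (‖u‖ ^ 2) := by
    have := (hasSum_isometryAverage (U := U) hw hw1 f).mapL (innerSL ℝ u)
    simpa [inner_smul_right, ← hu] using this
  have h2 := hw1.sub h1
  have h3 := le_hasSum h2 g fun h _ => by nlinarith [hw h, hin h]
  have h4 : ‖U g f - u‖ ^ 2 = 1 - 2 * inner ℝ u (U g f) + ‖u‖ ^ 2 := by
    rw [norm_sub_sq_real, real_inner_comm]; simp [hf]
  rw [h4]
  have h5 : ‖u‖ ^ 2 ≤ 1 := by nlinarith [norm_nonneg u]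
  nlinarith [hw g, mul_nonneg (hw g) (sub_nonneg.2 h5)]

theorem tendsto_norm_sub_isometryAverage [CompleteSpace E] (hw : ∀ g, 0 ≤ w g) (hw1 : HasSum w 1)
    {f : ℕ → E} (hf : ∀ k, ‖f k‖ = 1)
    (hlim : Tendsto (fun k => ‖isometryAverage U w (f k)‖) atTop (𝓝 1)) {g : Γ} (hg : 0 < w g) :
    Tendsto (fun k => ‖U g (f k) - isometryAverage U w (f k)‖) atTop (𝓝 0) := by
  have h1 : Tendsto (fun k => 2 * (1 - ‖isometryAverage U w (f k)‖ ^ 2) / w g) atTop (𝓝 0) := by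
    simpa using (((hlim.pow 2).const_sub 1).const_mul 2).div_const (w g)
  have h2 : Tendsto (fun k => ‖U g (f k) - isometryAverage U w (f k)‖ ^ 2) atTop (𝓝 0) := by
    refine squeeze_zero (fun k => by positivity) (fun k => ?_) h1
    rw [le_div_iff₀ hg, mul_comm]
    exact mul_norm_sub_isometryAverage_sq_le hw hw1 (hf k) g
  simpa using h2.sqrt

/-- If the average does not contract the norm by a definite factor, there are almost maximal
unit vectors. -/
theorem exists_tendsto_norm_isometryAverage (hw : ∀ g, 0 ≤ w g) (hw1 : HasSum w 1)
    (h : ¬ ∃ ρ : ℝ, 0 < ρ ∧ ρ < 1 ∧ ∀ f : E, ‖isometryAverage U w f‖ ≤ ρ * ‖f‖) :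
    ∃ f : ℕ → E, (∀ k, ‖f k‖ = 1) ∧
      Tendsto (fun k => ‖isometryAverage U w (f k)‖) atTop (𝓝 1) := by
  push Not at h
  have h1 (k : ℕ) : ∃ f : E, ‖f‖ = 1 ∧ 1 - 1 / ((k : ℝ) + 2) ≤ ‖isometryAverage U w f‖ := by
    have hk : 1 / ((k : ℝ) + 2) < 1 := by
      rw [div_lt_one (by positivity)]; linarith [(Nat.cast_nonneg k : (0 : ℝ) ≤ k)]
    have hk' : 0 < 1 / ((k : ℝ) + 2) := by positivity
    obtain ⟨f, hf⟩ := h (1 - 1 / ((k : ℝ) + 2)) (by linarith) (by linarith)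
    have hf0 : 0 < ‖f‖ := by
      rcases (norm_nonneg f).eq_or_lt with h0 | h0
      · have := norm_isometryAverage_le (U := U) hw hw1 f
        rw [← h0] at hf this
        linarith
      · exact h0
    refine ⟨‖f‖⁻¹ • f, by simp [norm_smul, hf0.ne'], ?_⟩
    rw [isometryAverage_smul, norm_smul, norm_inv, norm_norm, inv_mul_eq_div, le_div_iff₀ hf0]
    exact hf.le
  choose f hf hf' using h1
  refine ⟨f, hf, ?_⟩
  have h2 : Tendsto (fun k : ℕ => 1 - 1 / ((k : ℝ) + 2)) atTop (𝓝 1) := by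
    have := ((tendsto_const_div_atTop_nhds_zero_nat (1 : ℝ)).comp
      (tendsto_add_atTop_nat 2)).const_sub 1
    simpa [Function.comp_def] using this
  exact tendsto_of_tendsto_of_tendsto_of_le_of_le h2 tendsto_const_nhds hf'
    fun k => hf k ▸ norm_isometryAverage_le hw hw1 (f k)

end Average

/-! ### Restriction of square-summable functions to subsets -/

section Restriction

variable {Γ : Type*}

/-- The restriction `1_A f` of `f ∈ ℓ²(Γ)` to `A`. -/
noncomputable def lpRestrict (A : Set Γ) (f : lp (fun _ : Γ => ℝ) 2) : lp (fun _ : Γ => ℝ) 2 :=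
  ⟨A.indicator f, by
    refine memℓp_gen ?_
    refine ((lp.memℓp f).summable (by simp)).of_nonneg_of_le (fun x => by positivity) fun x => ?_
    exact Real.rpow_le_rpow (norm_nonneg _) (norm_indicator_le_norm_self f x) (by simp)⟩

theorem lpRestrict_apply (A : Set Γ) (f : lp (fun _ : Γ => ℝ) 2) (x : Γ) :
    lpRestrict A f x = A.indicator (fun y => (f y : ℝ)) x := rfl

theorem lpRestrict_sub (A : Set Γ) (f f' : lp (fun _ : Γ => ℝ) 2) :
    lpRestrict A (f - f') = lpRestrict A f - lpRestrict A f' := by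
  ext x
  exact congrFun (Set.indicator_sub A f f') x

theorem norm_lpRestrict_le (A : Set Γ) (f : lp (fun _ : Γ => ℝ) 2) : ‖lpRestrict A f‖ ≤ ‖f‖ :=
  lp.norm_mono (by simp) fun x => norm_indicator_le_norm_self f x

theorem norm_lpRestrict_union_sq {A B : Set Γ} (h : Disjoint A B) (f : lp (fun _ : Γ => ℝ) 2) :
    ‖lpRestrict (A ∪ B) f‖ ^ 2 = ‖lpRestrict A f‖ ^ 2 + ‖lpRestrict B f‖ ^ 2 := by
  have h1 : lpRestrict (A ∪ B) f = lpRestrict A f + lpRestrict B f := by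
    ext x
    exact congrFun (Set.indicator_union_of_disjoint h f) x
  have h2 : inner ℝ (lpRestrict A f) (lpRestrict B f) = 0 := by
    rw [lp.inner_eq_tsum]
    refine (tsum_congr fun x => ?_).trans tsum_zero
    by_cases hx : x ∈ A
    · simp [lpRestrict_apply, Set.disjoint_left.1 h hx]
    · simp [lpRestrict_apply, hx]
  rw [h1, norm_add_sq_real, h2]
  ring

theorem lpRestrict_univ (f : lp (fun _ : Γ => ℝ) 2) : lpRestrict Set.univ f = f := by
  ext x
  simp [lpRestrict_apply]

end Restriction

/-! ### Almost invariant vectors, amenability and Kesten's theorem -/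

section RightTranslation

variable {Γ : Type*} [Group Γ]

/-- Right translation `(U_g f) x = f (x g⁻¹)` on `ℓ²(Γ)`. -/
noncomputable def rightTranslation (g : Γ) :
    lp (fun _ : Γ => ℝ) 2 →ₗᵢ[ℝ] lp (fun _ : Γ => ℝ) 2 where
  toFun f := ⟨fun x => f (x * g⁻¹), by
    refine memℓp_gen ?_
    have := (lp.memℓp f).summable (by simp)
    exact (Equiv.mulRight g⁻¹).summable_iff.2 this⟩
  map_add' f f' := rfl
  map_smul' c f := rfl
  norm_map' f := by
    rw [lp.norm_eq_tsum_rpow (by simp), lp.norm_eq_tsum_rpow (by simp)]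
    congr 1
    exact (Equiv.mulRight g⁻¹).tsum_eq fun x => ‖f x‖ ^ (2 : ℝ≥0∞).toReal

@[simp]
theorem rightTranslation_apply (g : Γ) (f : lp (fun _ : Γ => ℝ) 2) (x : Γ) :
    rightTranslation g f x = f (x * g⁻¹) := rfl

theorem rightTranslation_mul (g h : Γ) (f : lp (fun _ : Γ => ℝ) 2) :
    rightTranslation (g * h) f = rightTranslation h (rightTranslation g f) := by
  ext x
  simp [mul_assoc]

/-- Since `(g • s)⁻¹ = s⁻¹ g⁻¹`, inversion turns the left translations of the mean into right
translations of `f`. -/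
theorem norm_lpRestrict_inv_smul (g : Γ) (s : Set Γ) (f : lp (fun _ : Γ => ℝ) 2) :
    ‖lpRestrict (g • s)⁻¹ f‖ = ‖lpRestrict s⁻¹ (rightTranslation g f)‖ := by
  rw [← (rightTranslation g⁻¹).norm_map (lpRestrict s⁻¹ _)]
  congr 1
  ext x
  have hx : x ∈ (g • s)⁻¹ ↔ x * g ∈ s⁻¹ := by
    simp only [Set.mem_inv, Set.mem_smul_set_iff_inv_smul_mem, mul_inv_rev, smul_eq_mul]
  rw [rightTranslation_apply, inv_inv, lpRestrict_apply, lpRestrict_apply]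
  by_cases h : x * g ∈ s⁻¹
  · rw [Set.indicator_of_mem h, Set.indicator_of_mem (hx.2 h)]
    simp
  · rw [Set.indicator_of_notMem h, Set.indicator_of_notMem (mt hx.1 h)]

/-- The mean of `s` is the ultrafilter limit of the `|f k|²`-mass of `s⁻¹`. -/
theorem isAmenableGroup_of_tendsto {f : ℕ → lp (fun _ : Γ => ℝ) 2} (hf : ∀ k, ‖f k‖ = 1)
    (hinv : ∀ g : Γ, Tendsto (fun k => ‖rightTranslation g (f k) - f k‖) atTop (𝓝 0)) :
    IsAmenableGroup Γ := by
  let F : Ultrafilter ℕ := hyperfilter ℕ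
  have hF : (F : Filter ℕ) ≤ atTop := Nat.hyperfilter_le_atTop
  let a (s : Set Γ) (k : ℕ) : ℝ≥0∞ := ENNReal.ofReal (‖lpRestrict s⁻¹ (f k)‖ ^ 2)
  -- Limits exist because `ℝ≥0∞` is compact.
  have hlim (s : Set Γ) : ∃ m, Tendsto (a s) F (𝓝 m) := by
    obtain ⟨m, -, hm⟩ := isCompact_univ.ultrafilter_le_nhds (F.map (a s)) (by simp)
    exact ⟨m, hm⟩
  choose m hm using hlim
  refine ⟨m, ?_, fun s t hst => ?_, fun g s => ?_⟩
  · refine tendsto_nhds_unique (hm _) ?_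
    simp only [a, Set.inv_univ, lpRestrict_univ, hf, one_pow, ENNReal.ofReal_one]
    exact tendsto_const_nhds
  · refine tendsto_nhds_unique (hm _) (((hm s).add (hm t)).congr fun k => ?_)
    have hd : Disjoint s⁻¹ t⁻¹ := by
      rw [Set.disjoint_left] at hst ⊢
      exact fun x hx hx' => hst hx hx'
    simp only [a]
    rw [Set.union_inv, norm_lpRestrict_union_sq hd,
      ENNReal.ofReal_add (by positivity) (by positivity)]
  -- Invariance is checked in `ℝ`, from `|a² - b²| ≤ 2 |a - b|` for norms `a, b ≤ 1`.
  · have hd : Tendsto (fun k => ‖lpRestrict (g • s)⁻¹ (f k)‖ ^ 2 - ‖lpRestrict s⁻¹ (f k)‖ ^ 2) F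
        (𝓝 0) := by
      have h0 : Tendsto (fun k => 2 * ‖rightTranslation g (f k) - f k‖) F (𝓝 0) := by
        simpa using ((hinv g).mono_left hF).const_mul 2
      refine squeeze_zero_norm (fun k => ?_) h0
      have h1 : |‖lpRestrict (g • s)⁻¹ (f k)‖ - ‖lpRestrict s⁻¹ (f k)‖| ≤
          ‖rightTranslation g (f k) - f k‖ := by
        rw [norm_lpRestrict_inv_smul]
        refine (abs_norm_sub_norm_le _ _).trans ?_
        rw [← lpRestrict_sub]
        exact norm_lpRestrict_le _ _
      have h2 := (norm_lpRestrict_le (g • s)⁻¹ (f k)).trans (hf k).le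
      have h3 := (norm_lpRestrict_le s⁻¹ (f k)).trans (hf k).le
      rw [Real.norm_eq_abs, sq_sub_sq, abs_mul]
      refine mul_le_mul ?_ h1 (abs_nonneg _) (by norm_num)
      rw [abs_of_nonneg (by positivity)]
      linarith
    have ha (s : Set Γ) (k : ℕ) : (a s k).toReal = ‖lpRestrict s⁻¹ (f k)‖ ^ 2 :=
      ENNReal.toReal_ofReal (by positivity)
    have hle (s : Set Γ) (k : ℕ) : a s k ≤ 1 := by
      rw [← ENNReal.ofReal_one]
      exact ENNReal.ofReal_le_ofReal
        (pow_le_one₀ (norm_nonneg _) ((norm_lpRestrict_le _ (f k)).trans (hf k).le))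
    have hfin (s : Set Γ) : m s ≠ ∞ :=
      ne_top_of_le_ne_top ENNReal.one_ne_top (le_of_tendsto' (hm s) (hle s))
    have hr (s : Set Γ) : Tendsto (fun k => ‖lpRestrict s⁻¹ (f k)‖ ^ 2) F (𝓝 (m s).toReal) :=
      ((ENNReal.tendsto_toReal (hfin s)).comp (hm s)).congr (ha s)
    have := tendsto_nhds_unique ((hr (g • s)).sub (hr s)) hd
    rw [← ENNReal.toReal_eq_toReal_iff' (hfin _) (hfin _)]
    linarith

/-- **Kesten's theorem**, one direction: on a nonamenable group, averaging with respect to weights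
which charge the identity and a generating set is a strict contraction of `ℓ²`. -/
theorem exists_norm_isometryAverage_le (hΓ : ¬ IsAmenableGroup Γ) {w : Γ → ℝ}
    (hw : ∀ g, 0 ≤ w g) (hw1 : HasSum w 1) (hone : 0 < w 1)
    (hgen : Subsemigroup.closure {g | 0 < w g} = ⊤) :
    ∃ ρ : ℝ, 0 < ρ ∧ ρ < 1 ∧ ∀ f, ‖isometryAverage rightTranslation w f‖ ≤ ρ * ‖f‖ := by
  by_contra h
  obtain ⟨f, hf, hlim⟩ := exists_tendsto_norm_isometryAverage hw hw1 h
  have htend {g : Γ} (hg : 0 < w g) := tendsto_norm_sub_isometryAverage hw hw1 hf hlim hg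
  refine hΓ (isAmenableGroup_of_tendsto hf fun g => ?_)
  have hU1 (k : ℕ) : rightTranslation 1 (f k) = f k := by ext x; simp
  induction (hgen ▸ Subsemigroup.mem_top g : g ∈ Subsemigroup.closure {g | 0 < w g}) using
    Subsemigroup.closure_induction with
  | mem g hg =>
    refine squeeze_zero (fun _ => norm_nonneg _) (fun k => ?_)
      (by simpa using (htend hg).add (htend hone))
    -- The charge at `1` makes `f k` itself close to its average, hence to `U_g (f k)`.
    rw [hU1, norm_sub_rev (f k)]
    exact norm_sub_le_norm_sub_add_norm_sub _ _ _
  | mul g h _ _ hg hh =>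
    refine squeeze_zero (fun _ => norm_nonneg _) (fun k => ?_) (by simpa using hg.add hh)
    rw [rightTranslation_mul]
    refine (norm_sub_le_norm_sub_add_norm_sub _ (rightTranslation h (f k)) _).trans ?_
    rw [← map_sub, LinearIsometry.norm_map]

end RightTranslation
-- Word norms
section WordNorm

variable {Γ : Type*} [Group Γ] {S : Finset Γ}

theorem mulCayley_adj_or_eq_mul {s : Γ} (hs : s ∈ S ∨ s⁻¹ ∈ S) (x : Γ) :
    (SimpleGraph.mulCayley (S : Set Γ)).Adj x (x * s) ∨ x = x * s := by
  rw [or_iff_not_imp_right, SimpleGraph.mulCayley_adj]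
  exact fun h => ⟨h, by simpa using hs⟩

theorem mulCayley_connected (hS : Subgroup.closure (S : Set Γ) = ⊤) :
    (SimpleGraph.mulCayley (S : Set Γ)).Connected := by
  have key {s : Γ} (hs : s ∈ S ∨ s⁻¹ ∈ S) (x : Γ) :
      (SimpleGraph.mulCayley (S : Set Γ)).Reachable x (x * s) := by
    rcases mulCayley_adj_or_eq_mul hs x with h | h
    · exact h.reachable
    · rw [← h]
  have h1 (x : Γ) : (SimpleGraph.mulCayley (S : Set Γ)).Reachable 1 x := by
    induction (hS ▸ Subgroup.mem_top x : x ∈ Subgroup.closure (S : Set Γ)) using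
      Subgroup.closure_induction_right with
    | one => rfl
    | mul_right x _ s hs h => exact h.trans (key (.inl hs) x)
    | mul_inv_cancel x _ s hs h => exact h.trans (key (.inr (by simpa using hs)) x)
  exact ⟨fun x y => (h1 x).symm.trans (h1 y)⟩

/-- Induction along a geodesic word representing `x`. -/
theorem wordNorm_induction (hS : Subgroup.closure (S : Set Γ) = ⊤) {p : ℕ → Γ → Prop}
    (one : p 0 1) (mul : ∀ n x s, s ∈ S ∨ s⁻¹ ∈ S → p n x → p (n + 1) (x * s)) (x : Γ) :
    p (wordNorm S x) x := by
  have key {u v : Γ} (q : (SimpleGraph.mulCayley (S : Set Γ)).Walk u v) :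
      ∀ k, p k u → p (k + q.length) v := by
    induction q with
    | nil => exact fun k hk => hk
    | @cons u v' v h q ih =>
      intro k hk
      have h2 := mul k u (u⁻¹ * v') (by
        simpa using ((SimpleGraph.mulCayley_adj _ _ _).1 h).2) hk
      rw [mul_inv_cancel_left] at h2
      have := ih (k + 1) h2
      rwa [SimpleGraph.Walk.length_cons, add_comm q.length, ← add_assoc]
  obtain ⟨q, hq⟩ := ((mulCayley_connected hS) 1 x).exists_walk_length_eq_dist
  have := key q 0 one
  rwa [hq, zero_add] at this

theorem wordNorm_one : wordNorm S (1 : Γ) = 0 := SimpleGraph.dist_self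

theorem wordNorm_mul_le (hS : Subgroup.closure (S : Set Γ) = ⊤) (x y : Γ) :
    wordNorm S (x * y) ≤ wordNorm S x + wordNorm S y := by
  refine wordNorm_induction hS (p := fun n y => wordNorm S (x * y) ≤ wordNorm S x + n)
    (by simp) (fun n y s hs h => ?_) y
  have h1 := (mulCayley_connected hS).dist_triangle (u := 1) (v := x * y) (w := x * (y * s))
  have h2 : (SimpleGraph.mulCayley (S : Set Γ)).dist (x * y) (x * (y * s)) ≤ 1 := by
    rw [← mul_assoc]
    rcases mulCayley_adj_or_eq_mul hs (x * y) with h | h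
    · exact (SimpleGraph.dist_eq_one_iff_adj.2 h).le
    · rw [← h]; simp
  simp only [wordNorm] at h ⊢
  omega

/-- Word norms are comparable. -/
theorem exists_wordNorm_le_mul (hS : Subgroup.closure (S : Set Γ) = ⊤) {T : Finset Γ}
    (hT : Subgroup.closure (T : Set Γ) = ⊤) :
    ∃ D : ℕ, 0 < D ∧ ∀ x, wordNorm S x ≤ D * wordNorm T x := by
  -- Both `t` and `t⁻¹` are counted, as either may be a letter of a geodesic word.
  let F (t : Γ) : ℕ := wordNorm S t + wordNorm S t⁻¹
  have hD {t : Γ} (ht : t ∈ T ∨ t⁻¹ ∈ T) : wordNorm S t ≤ 1 + ∑ t ∈ T, F t := by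
    rcases ht with ht | ht
    · have := Finset.single_le_sum (f := F) (fun _ _ => Nat.zero_le _) ht
      simp only [F] at this ⊢
      omega
    · have := Finset.single_le_sum (f := F) (fun _ _ => Nat.zero_le _) ht
      simp only [F, inv_inv] at this ⊢
      omega
  refine ⟨1 + ∑ t ∈ T, F t, by omega, wordNorm_induction hT
    (p := fun n x => wordNorm S x ≤ (1 + ∑ t ∈ T, F t) * n) (by simp [wordNorm_one]) ?_⟩
  intro n x s hs h
  have := wordNorm_mul_le hS x s
  have := hD hs
  rw [mul_add, mul_one]
  omega

end WordNorm

/-! ### Convolution powers: lower bound, moments, decay -/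

section ConvPow

variable {Γ : Type*} [Group Γ] (μ : PMF Γ)

/-- Splitting off the last increment exhibits the step as an average of right translations. -/
theorem convPow_succ_apply (n : ℕ) (x : Γ) :
    convPow μ (n + 1) x = ∑' h, μ h * convPow μ n (x * h⁻¹) := by
  have h1 (g : Γ) : (μ.map fun h => g * h) x = μ (g⁻¹ * x) := by
    rw [PMF.map_apply, tsum_eq_single (g⁻¹ * x)]
    · simp
    · intro h hh
      rw [if_neg]
      rintro rfl
      simp at hh
  rw [convPow, PMF.bind_apply, ← ((Equiv.inv Γ).trans (Equiv.mulLeft x)).tsum_eq]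
  refine tsum_congr fun h => ?_
  simp [h1, mul_comm]

theorem mul_le_convPow_add (m n : ℕ) (x y : Γ) :
    convPow μ m x * convPow μ n y ≤ convPow μ (m + n) (x * y) := by
  induction n generalizing y with
  | zero =>
    by_cases hy : y = 1
    · simp [convPow, hy]
    · simp [convPow, hy]
  | succ n ih =>
    rw [← add_assoc, convPow_succ_apply, convPow_succ_apply, ← ENNReal.tsum_mul_left]
    refine ENNReal.tsum_le_tsum fun h => ?_
    rw [mul_left_comm, mul_assoc]
    gcongr
    exact ih _

theorem exists_convPow_pos (hgen : IsGenerating μ) (x : Γ) : ∃ n, 0 < convPow μ n x := by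
  induction (hgen ▸ Subsemigroup.mem_top x : x ∈ Subsemigroup.closure μ.support) using
    Subsemigroup.closure_induction with
  | mem x hx =>
    refine ⟨1, ?_⟩
    rw [convPow_succ_apply]
    refine lt_of_lt_of_le ?_ (ENNReal.le_tsum x)
    simpa [convPow, pos_iff_ne_zero] using hx
  | mul x y _ _ hx hy =>
    obtain ⟨m, hm⟩ := hx
    obtain ⟨n, hn⟩ := hy
    exact ⟨m + n, (ENNReal.mul_pos hm.ne' hn.ne').trans_le (mul_le_convPow_add μ m n x y)⟩

theorem convPow_le_green (n : ℕ) (x y : Γ) : convPow μ n (x⁻¹ * y) ≤ green μ x y :=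
  ENNReal.le_tsum n

/-- Exponential lower bound for the Green function. -/
theorem exists_exp_le_green (hgen : IsGenerating μ) {S : Finset Γ}
    (hS : Subgroup.closure (S : Set Γ) = ⊤) :
    ∃ a : ℝ, 0 ≤ a ∧ ∀ x y,
      ENNReal.ofReal (Real.exp (-a * wordNorm S (x⁻¹ * y))) ≤ green μ x y := by
  classical
  choose k hk using exists_convPow_pos μ hgen
  -- The `1` keeps `c` finite even if `S` is empty, where the infimum is `∞`, and makes the exponent
  -- `-log c` nonnegative.
  let c : ℝ≥0∞ := min 1 ((S ∪ S⁻¹).inf fun s => convPow μ (k s) s)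
  have hc0 : 0 < c := lt_min one_pos ((Finset.lt_inf_iff ENNReal.zero_lt_top).2 fun s _ => hk s)
  have hc1 : c ≤ 1 := min_le_left _ _
  have hctop : c ≠ ∞ := ne_top_of_le_ne_top ENNReal.one_ne_top hc1
  have hcs {s : Γ} (hs : s ∈ S ∨ s⁻¹ ∈ S) : c ≤ convPow μ (k s) s :=
    (min_le_right _ _).trans (Finset.inf_le (by simpa using hs))
  have key (x : Γ) : ∃ m, c ^ wordNorm S x ≤ convPow μ m x := by
    refine wordNorm_induction hS (p := fun n x => ∃ m, c ^ n ≤ convPow μ m x)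
      ⟨0, by simp [convPow]⟩ ?_ x
    rintro n x s hs ⟨m, hm⟩
    exact ⟨m + k s, (pow_succ c n).le.trans <| (mul_le_mul' hm (hcs hs)).trans (mul_le_convPow_add μ _ _ _ _)⟩
  have hcr : 0 < c.toReal := ENNReal.toReal_pos hc0.ne' hctop
  refine ⟨-Real.log c.toReal, ?_, fun x y => ?_⟩
  · rw [neg_nonneg]
    exact Real.log_nonpos hcr.le (ENNReal.toReal_le_of_le_ofReal one_pos.le (by simpa using hc1))
  · obtain ⟨m, hm⟩ := key (x⁻¹ * y)
    refine le_trans ?_ (hm.trans (convPow_le_green μ m x y))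
    rw [neg_neg, mul_comm, Real.exp_nat_mul, Real.exp_log hcr, ENNReal.ofReal_pow hcr.le,
      ENNReal.ofReal_toReal hctop]

/-- A submultiplicative weight has submultiplicative moments under convolution; applied to `exp
(r‖x‖)`. -/
theorem tsum_mul_convPow_le {e : Γ → ℝ≥0∞} (he1 : e 1 ≤ 1) (hmul : ∀ x y, e (x * y) ≤ e x * e y)
    (n : ℕ) : ∑' x, e x * convPow μ n x ≤ (∑' x, e x * μ x) ^ n := by
  induction n with
  | zero =>
    rw [tsum_eq_single 1 fun x hx => by simp [convPow, hx]]
    simpa [convPow] using he1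
  | succ n ih =>
    calc ∑' x, e x * convPow μ (n + 1) x
        = ∑' h, ∑' x, e x * (μ h * convPow μ n (x * h⁻¹)) := by
          simp_rw [convPow_succ_apply, ← ENNReal.tsum_mul_left]
          exact ENNReal.tsum_comm
      _ = ∑' h, ∑' y, e (y * h) * (μ h * convPow μ n y) := by
          refine tsum_congr fun h => ?_
          rw [← (Equiv.mulRight h).tsum_eq]
          simp
      _ ≤ ∑' h, ∑' y, (e h * μ h) * (e y * convPow μ n y) := by
          refine ENNReal.tsum_le_tsum fun h => ENNReal.tsum_le_tsum fun y => ?_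
          calc e (y * h) * (μ h * convPow μ n y) ≤ e y * e h * (μ h * convPow μ n y) := by
                gcongr; exact hmul y h
            _ = _ := by ring
      _ = (∑' y, e y * convPow μ n y) * ∑' h, e h * μ h := by
          simp_rw [ENNReal.tsum_mul_left, ENNReal.tsum_mul_right]
          rw [mul_comm]
      _ ≤ _ := by rw [pow_succ]; gcongr

/-- Exponential decay of the convolution powers on a nonamenable group, when the walk is lazy. -/
theorem exists_convPow_le_pow (hΓ : ¬ IsAmenableGroup Γ) (hgen : IsGenerating μ)
    (hone : μ 1 ≠ 0) :
    ∃ ρ : ℝ, 0 < ρ ∧ ρ < 1 ∧ ∀ n x, (convPow μ n x).toReal ≤ ρ ^ n := by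
  classical
  let w (g : Γ) : ℝ := (μ g).toReal
  have hw1 : HasSum w 1 := by
    have := ENNReal.hasSum_toReal (f := μ) (by simp)
    rwa [← ENNReal.tsum_toReal_eq μ.apply_ne_top, μ.tsum_coe, ENNReal.toReal_one] at this
  have hw (g : Γ) : 0 ≤ w g := ENNReal.toReal_nonneg
  have hpos (g : Γ) : 0 < w g ↔ g ∈ μ.support := by
    rw [PMF.mem_support_iff, ENNReal.toReal_pos_iff, pos_iff_ne_zero]
    simp [(μ.apply_lt_top g)]
  obtain ⟨ρ, hρ0, hρ1, hρ⟩ := exists_norm_isometryAverage_le hΓ hw hw1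
    ((hpos 1).2 hone) (by simp_rw [hpos]; exact hgen)
  -- Iterating the average on `δ₁` produces `μ^{*n}`, whose values are bounded by its `ℓ²` norm.
  let v (n : ℕ) : lp (fun _ : Γ => ℝ) 2 :=
    (isometryAverage rightTranslation w)^[n] (lp.single 2 1 1)
  have hv (n : ℕ) : v (n + 1) = isometryAverage rightTranslation w (v n) :=
    Function.iterate_succ_apply' _ _ _
  have hnorm (n : ℕ) : ‖v n‖ ≤ ρ ^ n := by
    induction n with
    | zero => simp [v, lp.norm_single]
    | succ n ih =>
      rw [hv, pow_succ']
      exact (hρ _).trans (by gcongr)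
  have hval (n : ℕ) (x : Γ) : v n x = (convPow μ n x).toReal := by
    induction n generalizing x with
    | zero =>
      by_cases hx : x = 1
      · simp [v, convPow, hx]
      · simp [v, convPow, hx]
    | succ n ih =>
      have h1 := (hasSum_isometryAverage (U := rightTranslation) hw hw1 (v n)).mapL
        (lp.evalCLM ℝ (fun _ : Γ => ℝ) 2 x)
      rw [hv, convPow_succ_apply, ENNReal.tsum_toReal_eq fun h =>
        ENNReal.mul_ne_top (PMF.apply_ne_top _ _) (PMF.apply_ne_top _ _)]
      refine (h1.tsum_eq.symm.trans (tsum_congr fun h => ?_))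
      rw [ENNReal.toReal_mul, ← ih]
      rfl
  refine ⟨ρ, hρ0, hρ1, fun n x => ?_⟩
  rw [← hval]
  exact (le_abs_self _).trans ((lp.norm_apply_le_norm (by simp) (v n) x).trans (hnorm n))

end ConvPow

/-! ### Comparison with the lazy walk -/

section Lazy

variable {Γ : Type*} [Group Γ] (μ : PMF Γ)

/-- The lazy version `(δ₁ + μ) / 2` of `μ`. -/
noncomputable def lazyStep : PMF Γ :=
  ⟨fun g => (PMF.pure 1 g + μ g) / 2, by
    refine ENNReal.summable.hasSum_iff.2 ?_
    simp_rw [div_eq_mul_inv]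
    rw [ENNReal.tsum_mul_right, ENNReal.tsum_add, PMF.tsum_coe, PMF.tsum_coe, one_add_one_eq_two,
      ENNReal.mul_inv_cancel (by simp) (by simp)]⟩

theorem lazyStep_apply (g : Γ) : lazyStep μ g = (PMF.pure 1 g + μ g) / 2 := rfl

theorem lazyStep_one_ne_zero : lazyStep μ 1 ≠ 0 := by
  simp [lazyStep_apply]

theorem isGenerating_lazyStep (hgen : IsGenerating μ) : IsGenerating (lazyStep μ) := by
  refine top_le_iff.1 (hgen.symm.le.trans (Subsemigroup.closure_mono fun g hg => ?_))
  rw [PMF.mem_support_iff] at hg ⊢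
  simp [lazyStep_apply, hg]

theorem tsum_mul_lazyStep_lt_top {e : Γ → ℝ≥0∞} (he : e 1 ≠ ∞) (h : ∑' g, e g * μ g < ∞) :
    ∑' g, e g * lazyStep μ g < ∞ := by
  have h1 : ∑' g, e g * PMF.pure 1 g = e 1 := by
    rw [tsum_eq_single 1 fun x hx => by simp [hx]]
    simp
  simp_rw [lazyStep_apply, ← mul_div_assoc, mul_add, div_eq_mul_inv]
  rw [ENNReal.tsum_mul_right, ENNReal.tsum_add, h1]
  exact ENNReal.mul_lt_top (ENNReal.add_lt_top.2 ⟨he.lt_top, h⟩) (by simp)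

theorem tsum_convPow_eq (x : Γ) :
    ∑' n, convPow μ n x = PMF.pure 1 x + ∑' h, μ h * ∑' n, convPow μ n (x * h⁻¹) := by
  rw [tsum_eq_zero_add' ENNReal.summable]
  simp_rw [convPow_succ_apply, ← ENNReal.tsum_mul_left]
  rw [ENNReal.tsum_comm]
  rfl

/-- The Green function of `μ` is dominated by that of its lazy version. -/
theorem green_le_green_lazyStep (hfin : ∀ x y, green (lazyStep μ) x y ≠ ∞) (x y : Γ) :
    green μ x y ≤ green (lazyStep μ) x y := by
  let G (z : Γ) : ℝ≥0∞ := ∑' n, convPow (lazyStep μ) n z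
  have hG (z : Γ) : G z ≠ ∞ := by simpa [green] using hfin 1 z
  -- The lazy renewal equation reads `G = δ₁ + (G + μG) / 2`; cancelling `G`, which needs
  -- finiteness, gives `G = 2δ₁ + μG`.
  have hstep (z : Γ) : PMF.pure 1 z + ∑' h, μ h * G (z * h⁻¹) ≤ G z := by
    have h1 : ∑' h, PMF.pure 1 h * G (z * h⁻¹) = G z := by
      rw [tsum_eq_single 1 fun x hx => by simp [hx]]
      simp
    have h2 : G z = PMF.pure 1 z + (G z + ∑' h, μ h * G (z * h⁻¹)) / 2 := by
      conv_lhs => rw [show G z = _ from tsum_convPow_eq (lazyStep μ) z]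
      rw [← h1, ← ENNReal.tsum_add, div_eq_mul_inv, ← ENNReal.tsum_mul_right]
      congr 1
      refine tsum_congr fun h => ?_
      rw [lazyStep_apply, div_eq_mul_inv, ← add_mul]
      exact mul_right_comm _ _ _
    set T := ∑' h, μ h * G (z * h⁻¹)
    have h3 : G z + G z = G z + (2 * PMF.pure 1 z + T) := by
      conv_lhs => rw [← two_mul, h2, mul_add, ENNReal.mul_div_cancel (by simp) (by simp)]
      ring
    rw [(ENNReal.add_right_inj (hG z)).1 h3]
    gcongr
    exact le_mul_of_one_le_left' one_le_two
  -- Minimality: a supersolution of `δ₁ + μG ≤ G` dominates all partial sums of the Green series of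
  -- `μ`.
  have hpart (n : ℕ) (z : Γ) : ∑ k ∈ Finset.range n, convPow μ k z ≤ G z := by
    induction n generalizing z with
    | zero => simp
    | succ n ih =>
      rw [Finset.sum_range_succ']
      simp_rw [convPow_succ_apply]
      rw [← Summable.tsum_finsetSum fun _ _ => ENNReal.summable, add_comm]
      refine le_trans ?_ (hstep z)
      refine add_le_add le_rfl (ENNReal.tsum_le_tsum fun h => ?_)
      rw [← Finset.mul_sum]
      gcongr
      exact ih _
  exact ENNReal.tsum_le_of_sum_range_le fun n => hpart n _

end Lazy

/-! ### Bounds on the Green function and the Green metric -/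

section Green

variable {Γ : Type*} [Group Γ] (μ : PMF Γ)

/-- Interpolation between a bound decaying in `n` and a bound decaying in `L`. -/
theorem exists_geometric_bound {ρ M r : ℝ} (hρ0 : 0 < ρ) (hρ1 : ρ < 1) (hr : 0 < r) :
    ∃ q c : ℝ, 0 < q ∧ q < 1 ∧ 0 < c ∧ ∀ (n : ℕ) (a L : ℝ), a ≤ ρ ^ n →
      Real.exp (r * L) * a ≤ M ^ n → a ≤ q ^ n * Real.exp (-c * L) := by
  set α := -Real.log ρ with hα
  have hα0 : 0 < α := neg_pos.2 (Real.log_neg hρ0 hρ1)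
  set N := max |M| 1
  have hN : 0 < N := lt_max_of_lt_right one_pos
  set β := Real.log N with hβ
  have hβ0 : 0 ≤ β := Real.log_nonneg (le_max_right _ _)
  -- Writing `a = a ^ (1 - θ) * a ^ θ`, this `θ` solves `(1 - θ) α - θ β = α / 2`, so half of the
  -- decay in `n` survives.
  set θ := α / (2 * (α + β)) with hθ
  have hθ0 : 0 < θ := by positivity
  have hθ1 : θ ≤ 1 := by
    rw [hθ, div_le_one (by positivity)]
    linarith
  have hθe : θ * (α + β) = α / 2 := by
    rw [hθ]; field_simp
  refine ⟨Real.exp (-(α / 2)), θ * r, Real.exp_pos _, by simpa using hα0, by positivity, ?_⟩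
  intro n a L h1 h2
  rcases le_or_gt a 0 with ha | ha
  · exact ha.trans (by positivity)
  have l1 : Real.log a ≤ -(n * α) := by
    have := Real.log_le_log ha h1
    rw [Real.log_pow] at this
    linarith
  have l2 : r * L + Real.log a ≤ n * β := by
    have h3 : Real.exp (r * L) * a ≤ N ^ n :=
      h2.trans ((le_abs_self _).trans (by rw [abs_pow]; gcongr; exact le_max_left _ _))
    have := Real.log_le_log (by positivity) h3
    rwa [Real.log_pow, Real.log_mul (Real.exp_ne_zero _) ha.ne', Real.log_exp] at this
  rw [← Real.exp_nat_mul, ← Real.exp_add, ← Real.log_le_iff_le_exp ha]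
  have l3 : (n : ℝ) * (θ * (α + β)) = n * (α / 2) := by rw [hθe]
  nlinarith [mul_le_mul_of_nonneg_left l1 (sub_nonneg.2 hθ1), mul_le_mul_of_nonneg_left l2 hθ0.le]

theorem HasFiniteExpMoment.of_generators {μ : PMF Γ} (hexp : HasFiniteExpMoment μ) {S : Finset Γ}
    (hS : Subgroup.closure (S : Set Γ) = ⊤) :
    ∃ r : ℝ, 0 < r ∧ ∑' g : Γ, ENNReal.ofReal (Real.exp (r * wordNorm S g)) * μ g < ∞ := by
  obtain ⟨T, hT, r, hr, h⟩ := hexp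
  obtain ⟨D, hD, hle⟩ := exists_wordNorm_le_mul hS hT
  have hD' : (0 : ℝ) < D := by exact_mod_cast hD
  refine ⟨r / D, by positivity, lt_of_le_of_lt (ENNReal.tsum_le_tsum fun g => ?_) h⟩
  refine mul_le_mul_left (ENNReal.ofReal_le_ofReal (Real.exp_le_exp.2 ?_)) _
  rw [div_mul_eq_mul_div, div_le_iff₀ hD', mul_assoc]
  gcongr
  rw [mul_comm]
  exact_mod_cast hle g

theorem exists_green_le_exp_of_lazy (hΓ : ¬ IsAmenableGroup Γ) (hgen : IsGenerating μ)
    (hone : μ 1 ≠ 0) {S : Finset Γ} (hS : Subgroup.closure (S : Set Γ) = ⊤) {r : ℝ} (hr : 0 < r)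
    (hexp : ∑' g : Γ, ENNReal.ofReal (Real.exp (r * wordNorm S g)) * μ g < ∞) :
    ∃ b c : ℝ, 0 < b ∧ 0 < c ∧ ∀ x y,
      green μ x y ≤ ENNReal.ofReal (b * Real.exp (-c * wordNorm S (x⁻¹ * y))) := by
  obtain ⟨ρ, hρ0, hρ1, hρ⟩ := exists_convPow_le_pow μ hΓ hgen hone
  let e (g : Γ) : ℝ≥0∞ := ENNReal.ofReal (Real.exp (r * wordNorm S g))
  have he1 : e 1 ≤ 1 := by simp [e, wordNorm_one]
  have hemul (x y : Γ) : e (x * y) ≤ e x * e y := by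
    simp only [e]
    rw [← ENNReal.ofReal_mul (Real.exp_pos _).le, ← Real.exp_add, ← mul_add]
    gcongr
    exact_mod_cast wordNorm_mul_le hS x y
  set M := ∑' g, e g * μ g
  obtain ⟨q, c, hq0, hq1, hc, hq⟩ := exists_geometric_bound (M := M.toReal) hρ0 hρ1 hr
  have hconv (n : ℕ) (x : Γ) :
      convPow μ n x ≤ ENNReal.ofReal (q ^ n * Real.exp (-c * wordNorm S x)) := by
    rw [← ENNReal.ofReal_toReal (PMF.apply_ne_top (convPow μ n) x)]
    refine ENNReal.ofReal_le_ofReal (hq n _ _ (hρ n x) ?_)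
    have h1 : e x * convPow μ n x ≤ M ^ n :=
      (ENNReal.le_tsum x).trans (tsum_mul_convPow_le μ he1 hemul n)
    have h2 := ENNReal.toReal_mono (ENNReal.pow_ne_top hexp.ne) h1
    rwa [ENNReal.toReal_mul, ENNReal.toReal_pow, ENNReal.toReal_ofReal (Real.exp_pos _).le] at h2
  refine ⟨(1 - q)⁻¹, c, inv_pos.2 (sub_pos.2 hq1), hc, fun x y => ?_⟩
  refine (ENNReal.tsum_le_tsum fun n => hconv n _).trans ?_
  have hs := (hasSum_geometric_of_lt_one hq0.le hq1).mul_right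
    (Real.exp (-c * wordNorm S (x⁻¹ * y)))
  rw [← ENNReal.ofReal_tsum_of_nonneg (fun n => by positivity) hs.summable, hs.tsum_eq]

/-- Exponential upper bound for the Green function. -/
theorem exists_green_le_exp (hΓ : ¬ IsAmenableGroup Γ) (hgen : IsGenerating μ)
    (hexp : HasFiniteExpMoment μ) {S : Finset Γ} (hS : Subgroup.closure (S : Set Γ) = ⊤) :
    ∃ b c : ℝ, 0 < b ∧ 0 < c ∧ ∀ x y,
      green μ x y ≤ ENNReal.ofReal (b * Real.exp (-c * wordNorm S (x⁻¹ * y))) := by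
  obtain ⟨r, hr, hfin⟩ := hexp.of_generators hS
  obtain ⟨b, c, hb, hc, h⟩ := exists_green_le_exp_of_lazy (lazyStep μ) hΓ
    (isGenerating_lazyStep μ hgen) (lazyStep_one_ne_zero μ) hS hr
    (tsum_mul_lazyStep_lt_top μ (by simp) hfin)
  exact ⟨b, c, hb, hc, fun x y => (green_le_green_lazyStep μ
    (fun x y => ne_top_of_le_ne_top ENNReal.ofReal_ne_top (h x y)) x y).trans (h x y)⟩

/-- The form `1 ≤ C` gives `log C ≥ 0` and lets `C` serve as the multiplicative constant of the
quasi-isometry. -/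
theorem exists_green_bounds (hΓ : ¬ IsAmenableGroup Γ) (hgen : IsGenerating μ)
    (hexp : HasFiniteExpMoment μ) {S : Finset Γ} (hS : Subgroup.closure (S : Set Γ) = ⊤) :
    ∃ C : ℝ, 1 ≤ C ∧ ∀ x y : Γ,
      ENNReal.ofReal (Real.exp (-C * (wordNorm S (x⁻¹ * y) : ℝ)) / C) ≤ green μ x y ∧
      green μ x y ≤ ENNReal.ofReal (C * Real.exp (-(wordNorm S (x⁻¹ * y) : ℝ) / C)) := by
  obtain ⟨a, ha, hlow⟩ := exists_exp_le_green μ hgen hS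
  obtain ⟨b, c, hb, hc, hup⟩ := exists_green_le_exp μ hΓ hgen hexp hS
  have hc' : 0 < c⁻¹ := inv_pos.2 hc
  have hC : 1 ≤ 1 + a + b + c⁻¹ := by linarith
  refine ⟨1 + a + b + c⁻¹, hC, fun x y => ⟨le_trans ?_ (hlow x y), (hup x y).trans ?_⟩⟩
  · refine ENNReal.ofReal_le_ofReal ((div_le_self (Real.exp_pos _).le hC).trans ?_)
    gcongr
    linarith
  · refine ENNReal.ofReal_le_ofReal (mul_le_mul (by linarith) ?_ (Real.exp_pos _).le (by linarith))
    rw [Real.exp_le_exp, neg_div, neg_mul, neg_le_neg_iff, div_le_iff₀ (by linarith)]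
    have : 1 ≤ c * (1 + a + b + c⁻¹) := by
      rw [mul_add, mul_inv_cancel₀ hc.ne']
      have : 0 ≤ c * (1 + a + b) := by positivity
      linarith
    calc (wordNorm S (x⁻¹ * y) : ℝ) = wordNorm S (x⁻¹ * y) * 1 := (mul_one _).symm
      _ ≤ wordNorm S (x⁻¹ * y) * (c * (1 + a + b + c⁻¹)) := by gcongr
      _ = _ := by ring

end Green

theorem mainTheorem9 {Γ : Type*} [Group Γ] (hΓ : ¬ IsAmenableGroup Γ)
    (μ : PMF Γ) (hgen : IsGenerating μ) (hexp : HasFiniteExpMoment μ)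
    (S : Finset Γ) (hS : Subgroup.closure (S : Set Γ) = ⊤) :
    (∃ C : ℝ, 0 < C ∧ ∀ x y : Γ,
      ENNReal.ofReal (Real.exp (-C * (wordNorm S (x⁻¹ * y) : ℝ)) / C) ≤ green μ x y ∧
      green μ x y ≤ ENNReal.ofReal (C * Real.exp (-(wordNorm S (x⁻¹ * y) : ℝ) / C))) ∧
    IsQuasiIsometry (fun x y : Γ => (wordNorm S (x⁻¹ * y) : ℝ)) (greenDist μ) id := by
  obtain ⟨C, hC, h⟩ := exists_green_bounds μ hΓ hgen hexp hS
  have hC0 : 0 < C := by linarith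
  have hlog : 0 ≤ Real.log C := Real.log_nonneg hC
  refine ⟨⟨C, hC0, h⟩, ?_⟩
  have hfin (x y : Γ) : green μ x y ≠ ∞ := ne_top_of_le_ne_top ENNReal.ofReal_ne_top (h x y).2
  have hle (x y : Γ) := (ENNReal.ofReal_le_iff_le_toReal (hfin x y)).1 (h x y).1
  have hge (x y : Γ) := ENNReal.toReal_le_of_le_ofReal (by positivity) (h x y).2
  have hpos (x y : Γ) : 0 < (green μ x y).toReal := lt_of_lt_of_le (by positivity) (hle x y)
  have hlow (x y : Γ) :
      -C * (wordNorm S (x⁻¹ * y) : ℝ) - Real.log C ≤ Real.log (green μ x y).toReal := by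
    have := Real.log_le_log (by positivity) (hle x y)
    rwa [Real.log_div (Real.exp_ne_zero _) hC0.ne', Real.log_exp] at this
  have hup (x y : Γ) :
      Real.log (green μ x y).toReal ≤ Real.log C + -(wordNorm S (x⁻¹ * y) : ℝ) / C := by
    have := Real.log_le_log (hpos x y) (hge x y)
    rwa [Real.log_mul hC0.ne' (Real.exp_ne_zero _), Real.log_exp] at this
  set ℓ := Real.log (green μ 1 1).toReal with hℓ
  have hd (x y : Γ) : greenDist μ x y = ℓ - Real.log (green μ x y).toReal := by
    rw [greenDist, Real.log_div (hpos x y).ne' (hpos 1 1).ne', neg_sub]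
  have hself (y : Γ) : greenDist μ y y = 0 := by
    rw [hd, sub_eq_zero, hℓ]
    simp [green]
  -- The additive error collects `log C` from the prefactors and `|ℓ|` from the normalisation by
  -- `G(1, 1)`.
  refine ⟨C, Real.log C + |ℓ|, hC, by positivity, fun x y => ⟨?_, ?_⟩, fun y => ⟨y, ?_⟩⟩
  · rw [id, id, hd]
    have := hup x y
    rw [neg_div] at this
    linarith [neg_abs_le ℓ]
  · rw [id, id, hd]
    linarith [hlow x y, le_abs_self ℓ]
  · rw [id, hself]
    constructor <;> positivity
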